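/- Let $(M,\pi)$ be a (smooth, finite-dimensional, Hausdorff) Poisson manifold, i.e. $\pi\in\Gamma(\bigwedge^2TM)$ is a smooth bivector field for which $\{f,g\}=\pi(df,dg)$ satisfies the Jacobi identity on $C^\infty(M)$. Let $c\in C^\infty(M)$ be a Casimir function of $\pi$ (i.e. $\{c,f\}=0$ for all $f\in C^\infty(M)$), and let $v\in\Gamma^\infty(TM)$ be a smooth vector field with $\mathcal L_v\pi=0$. For $\alpha\in\Gamma^\infty(T^*M)$ let $\pi(\alpha,\cdot)$ denote the vector field with $\beta(\pi(\alpha,\cdot))=\pi(\alpha,\beta)$ for all 1-forms $\beta$. Then the cotangent bundle $T^*M$ is a Lie algebroid, where the Lie bracket $[\cdot,\cdot]_{c,v}:\Gamma^\infty(T^*M)\times\Gamma^\infty(T^*M)\to\Gamma^\infty(T^*M)$ and the anchor $a_{c,v}:T^*M\to TM$ (a smooth vector bundle map over $\mathrm{id}_M$) are given by $$[\alpha,\beta]_{c,v}=\mathcal L_{\pi(\alpha,\cdot)}\beta-\mathcal L_{\pi(\beta,\cdot)}\alpha-d(\pi(\alpha,\beta))+c\,\bigl(\beta(v)\,\mathcal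 L_v\alpha-\alpha(v)\,\mathcal L_v\beta\bigr),$$ $$a_{c,v}(\alpha)(f)=\pi(\alpha,df)-c\,\alpha(v)\,df(v),$$ for all $\alpha,\beta\in\Gamma^\infty(T^*M)$ and $f\in C^\infty(M)$. That is, $[\cdot,\cdot]_{c,v}$ is an $\mathbb R$-bilinear, alternating bracket satisfying the Jacobi identity, and $[\alpha,f\beta]_{c,v}=f[\alpha,\beta]_{c,v}+a_{c,v}(\alpha)(f)\,\beta$ and $a_{c,v}([\alpha,\beta]_{c,v})=[a_{c,v}(\alpha),a_{c,v}(\beta)]$ for all $\alpha,\beta\in\Gamma^\infty(T^*M)$ and $f\in C^\infty(M)$. -/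

import Mathlib

set_option maxSynthPendingDepth 3

open scoped Manifold ContDiff
open Bundle (TotalSpace Trivial)

namespace PoissonGeometry

section SectionModule

variable {E : Type*} [NormedAddCommGroup E] [NormedSpace ℝ E]
  {M : Type*} [TopologicalSpace M] [ChartedSpace E M]
  {F : Type*} [NormedAddCommGroup F] [NormedSpace ℝ F]
  {V : M → Type*} [TopologicalSpace (TotalSpace F V)] [∀ x, TopologicalSpace (V x)]
  [∀ x, AddCommGroup (V x)] [∀ x, Module ℝ (V x)] [FiberBundle F V] [VectorBundle ℝ F V]

/-- The pointwise product of a smooth function and a smooth section of a vector bundle. -/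
noncomputable instance : SMul C^∞⟮𝓘(ℝ, E), M; ℝ⟯ Cₛ^∞⟮𝓘(ℝ, E); F, V⟯ :=
  ⟨fun f s => ⟨fun x => f x • s x, f.contMDiff.smul_section s.contMDiff⟩⟩

theorem coe_fun_smul (f : C^∞⟮𝓘(ℝ, E), M; ℝ⟯) (s : Cₛ^∞⟮𝓘(ℝ, E); F, V⟯) (x : M) :
    (f • s) x = f x • s x := rfl

end SectionModule

section Objects

variable (E : Type*) [NormedAddCommGroup E] [NormedSpace ℝ E]
  (M : Type*) [TopologicalSpace M] [ChartedSpace E M]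

/-- Smooth real functions on `M`. -/
abbrev SmoothFunction := C^∞⟮𝓘(ℝ, E), M; ℝ⟯

variable {M} in
/-- The fibre `T*_x M` of the cotangent bundle. -/
abbrev CotangentSpace (x : M) : Type _ := TangentSpace 𝓘(ℝ, E) x →L[ℝ] Trivial M ℝ x

variable [IsManifold 𝓘(ℝ, E) ∞ M]

/-- Smooth vector fields: smooth sections of `TM`. -/
abbrev SmoothVectorField := Cₛ^∞⟮𝓘(ℝ, E); E, (TangentSpace 𝓘(ℝ, E) : M → Type _)⟯

/-- Smooth 1-forms: smooth sections of `T*M`. -/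
abbrev OneForm := Cₛ^∞⟮𝓘(ℝ, E); E →L[ℝ] ℝ, (CotangentSpace E : M → Type _)⟯

/-- Smooth bivector fields: smooth sections of the bundle of bilinear forms on `T*M`
which are alternating at each point. -/
structure Bivector where
  /-- the underlying section of the bundle of bilinear forms on `T*M` -/
  form : Cₛ^∞⟮𝓘(ℝ, E); (E →L[ℝ] ℝ) →L[ℝ] (E →L[ℝ] ℝ) →L[ℝ] ℝ,
    (fun x : M => CotangentSpace E x →L[ℝ] CotangentSpace E x →L[ℝ] Trivial M ℝ x)⟯
  alternating : ∀ (x : M) (α : CotangentSpace E x), form x α α = 0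

end Objects

section Operations

variable {E : Type*} [NormedAddCommGroup E] [NormedSpace ℝ E]
  {M : Type*} [TopologicalSpace M] [ChartedSpace E M]

theorem exists_vector_of_bidual [FiniteDimensional ℝ E] (x : M) (φ : CotangentSpace E x →L[ℝ] Trivial M ℝ x) :
    ∃ X : TangentSpace 𝓘(ℝ, E) x, ∀ β : CotangentSpace E x, β X = φ β := by
  let φ' : Module.Dual ℝ (Module.Dual ℝ E) :=
    (show (E →L[ℝ] ℝ) →L[ℝ] ℝ from φ).toLinearMap ∘ₗ
      (LinearMap.toContinuousLinearMap : (E →ₗ[ℝ] ℝ) ≃ₗ[ℝ] (E →L[ℝ] ℝ)).toLinearMap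
  refine ⟨(Module.evalEquiv ℝ E).symm φ', fun β => ?_⟩
  have := Module.apply_evalEquiv_symm_apply (R := ℝ) (M := E) (show E →L[ℝ] ℝ from β).toLinearMap φ'
  exact this

variable [IsManifold 𝓘(ℝ, E) ∞ M]

theorem contMDiffAt_pair {T : Π x : M, CotangentSpace E x} {W : Π x : M, TangentSpace 𝓘(ℝ, E) x}
    {x : M}
    (hT : ContMDiffAt 𝓘(ℝ, E) (𝓘(ℝ, E).prod 𝓘(ℝ, E →L[ℝ] ℝ)) ∞
      (fun y => TotalSpace.mk' (E →L[ℝ] ℝ) (E := (CotangentSpace E : M → Type _)) y (T y)) x)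
    (hW : ContMDiffAt 𝓘(ℝ, E) (𝓘(ℝ, E).prod 𝓘(ℝ, E)) ∞
      (fun y => TotalSpace.mk' E (E := (TangentSpace 𝓘(ℝ, E) : M → Type _)) y (W y)) x) :
    ContMDiffAt 𝓘(ℝ, E) 𝓘(ℝ, ℝ) ∞ (fun y => (T y (W y) : ℝ)) x := by
  have := ContMDiffAt.clm_bundle_apply hT hW
  simp only [Bundle.contMDiffAt_totalSpace] at this
  exact this.2

/-- The function `α(X)`. -/
noncomputable def OneForm.pair (α : OneForm E M) (X : SmoothVectorField E M) : SmoothFunction E M :=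
  ⟨fun x => α x (X x), fun x => contMDiffAt_pair (α.contMDiff x) (X.contMDiff x)⟩

/-- The function `π(α, β)`. -/
noncomputable def Bivector.eval (π : Bivector E M) (α β : OneForm E M) : SmoothFunction E M :=
  ⟨fun x => π.form x (α x) (β x), fun x => by
    have := ContMDiffAt.clm_bundle_apply₂ (π.form.contMDiff x) (α.contMDiff x) (β.contMDiff x)
    simp only [Bundle.contMDiffAt_totalSpace] at this
    exact this.2⟩

theorem contMDiffAt_mvfderiv {f : M → ℝ} {X : Π x : M, TangentSpace 𝓘(ℝ, E) x} {x : M}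
    (hf : ContMDiffAt 𝓘(ℝ, E) 𝓘(ℝ, ℝ) ∞ f x)
    (hX : ContMDiffAt 𝓘(ℝ, E) (𝓘(ℝ, E).prod 𝓘(ℝ, E)) ∞
      (fun y => TotalSpace.mk' E (E := (TangentSpace 𝓘(ℝ, E) : M → Type _)) y (X y)) x) :
    ContMDiffAt 𝓘(ℝ, E) 𝓘(ℝ, ℝ) ∞ (fun y => mvfderiv 𝓘(ℝ, E) f y (X y)) x := by
  have h1 := hf.mfderiv_const (m := ∞) (by simp)
  have h2 := ContMDiffAt.clm_apply_of_inCoordinates (b₁ := id) (b₂ := f)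
    (E₁ := (TangentSpace 𝓘(ℝ, E) : M → Type _)) (E₂ := (TangentSpace 𝓘(ℝ, ℝ) : ℝ → Type _))
    h1 hX hf
  rw [Bundle.contMDiffAt_totalSpace] at h2
  refine h2.2.congr_of_eventuallyEq (Filter.Eventually.of_forall fun y => ?_)
  simp [mvfderiv]
  rfl

variable [FiniteDimensional ℝ E]

/-- A field of covectors is smooth as soon as its pairings with smooth local vector fields are. -/
theorem contMDiffAt_covector {T : Π x : M, CotangentSpace E x} {x : M}
    (h : ∀ w : TangentSpace 𝓘(ℝ, E) x,
      ContMDiffAt 𝓘(ℝ, E) 𝓘(ℝ, ℝ) ∞ (fun y => (T y (FiberBundle.extend E w y) : ℝ)) x) :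
    ContMDiffAt 𝓘(ℝ, E) (𝓘(ℝ, E).prod 𝓘(ℝ, E →L[ℝ] ℝ)) ∞
      (fun y => TotalSpace.mk' (E →L[ℝ] ℝ) (E := (CotangentSpace E : M → Type _)) y (T y)) x := by
  rw [contMDiffAt_hom_bundle]
  refine ⟨contMDiffAt_id, ?_⟩
  let t := trivializationAt E (TangentSpace 𝓘(ℝ, E) : M → Type _) x
  have hx : x ∈ t.baseSet := FiberBundle.mem_baseSet_trivializationAt' x
  let b := Module.finBasis ℝ E
  have key : ContMDiffAt 𝓘(ℝ, E) 𝓘(ℝ, E →L[ℝ] ℝ) ∞ (fun y => ∑ i,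
      (T y (FiberBundle.extend E (t.symm x (b i)) y) : ℝ) •
        (LinearMap.toContinuousLinearMap (b.coord i) : E →L[ℝ] ℝ)) x :=
    ContMDiffAt.sum fun i _ => (h (t.symm x (b i))).smul contMDiffAt_const
  refine key.congr_of_eventuallyEq ?_
  filter_upwards [t.open_baseSet.mem_nhds hx] with y hy
  have hx' : y ∈ (trivializationAt ℝ (Trivial M ℝ) x).baseSet := trivial
  have hs (e : E) : ContinuousLinearMap.inCoordinates E (TangentSpace 𝓘(ℝ, E)) ℝ (Trivial M ℝ)
      x y x y (T y) e = T y (t.symm y e) := by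
    rw [ContinuousLinearMap.inCoordinates_eq hy hx']
    simp [t]
  have he (e : E) : FiberBundle.extend E (t.symm x e) y = t.symm y e := by
    simp only [FiberBundle.extend]
    change t.symm y (t ⟨x, t.symm x e⟩).2 = _
    rw [t.apply_mk_symm hx]
  ext e
  rw [hs]
  simp only [he, sum_apply, smul_apply, smul_eq_mul]
  have hr := b.sum_repr e
  conv_lhs => rw [← hr]
  have hl : (T y (t.symm y (∑ i, b.repr e i • b i)) : ℝ) =
      ((T y : TangentSpace 𝓘(ℝ, E) y →L[ℝ] ℝ) ∘L t.symmL ℝ y) (∑ i, b.repr e i • b i) := by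
    rw [ContinuousLinearMap.comp_apply, t.symmL_apply hy]
  rw [hl, map_sum]
  refine Finset.sum_congr rfl fun i _ => ?_
  rw [map_smul, ContinuousLinearMap.comp_apply, t.symmL_apply hy]
  exact mul_comm _ _

/-- A field of tangent vectors is smooth as soon as its pairings with smooth local 1-forms are. -/
theorem contMDiffAt_vector {X : Π x : M, TangentSpace 𝓘(ℝ, E) x} {x : M}
    (h : ∀ T : Π x : M, CotangentSpace E x, ContMDiffAt 𝓘(ℝ, E) (𝓘(ℝ, E).prod 𝓘(ℝ, E →L[ℝ] ℝ)) ∞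
      (fun y => TotalSpace.mk' (E →L[ℝ] ℝ) (E := (CotangentSpace E : M → Type _)) y (T y)) x →
      ContMDiffAt 𝓘(ℝ, E) 𝓘(ℝ, ℝ) ∞ (fun y => (T y (X y) : ℝ)) x) :
    ContMDiffAt 𝓘(ℝ, E) (𝓘(ℝ, E).prod 𝓘(ℝ, E)) ∞
      (fun y => TotalSpace.mk' E (E := (TangentSpace 𝓘(ℝ, E) : M → Type _)) y (X y)) x := by
  let t := trivializationAt E (TangentSpace 𝓘(ℝ, E) : M → Type _) x
  have hx : x ∈ t.baseSet := FiberBundle.mem_baseSet_trivializationAt' x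
  let b := Module.finBasis ℝ E
  rw [Bundle.contMDiffAt_section]
  have key : ContMDiffAt 𝓘(ℝ, E) 𝓘(ℝ, E) ∞ (fun y => ∑ i,
      ((LinearMap.toContinuousLinearMap (b.coord i) : E →L[ℝ] ℝ)
        (t.continuousLinearMapAt ℝ y (X y))) • b i) x := by
    refine ContMDiffAt.sum fun i _ => ContMDiffAt.smul (h (fun y =>
      (LinearMap.toContinuousLinearMap (b.coord i) : E →L[ℝ] ℝ) ∘L
        t.continuousLinearMapAt ℝ y) (contMDiffAt_covector fun w => ?_)) contMDiffAt_const
    have : ContMDiffAt 𝓘(ℝ, E) 𝓘(ℝ, ℝ) ∞ (fun _ : M => b.coord i (t ⟨x, w⟩).2) x :=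
      contMDiffAt_const
    refine this.congr_of_eventuallyEq ?_
    filter_upwards [t.open_baseSet.mem_nhds hx] with y hy
    simp only [ContinuousLinearMap.comp_apply, FiberBundle.extend]
    change b.coord i (t.continuousLinearMapAt ℝ y (t.symm y (t ⟨x, w⟩).2)) = _
    rw [t.continuousLinearMapAt_apply_of_mem ℝ hy, t.apply_mk_symm hy]
  refine key.congr_of_eventuallyEq ?_
  filter_upwards [t.open_baseSet.mem_nhds hx] with y hy
  rw [t.continuousLinearMapAt_apply_of_mem ℝ hy]
  exact (b.sum_repr _).symm

/-- The differential `df`. -/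
noncomputable def differential (f : SmoothFunction E M) : OneForm E M :=
  ⟨fun x => mvfderiv 𝓘(ℝ, E) f x, fun _ => contMDiffAt_covector fun _ =>
    contMDiffAt_mvfderiv (f.contMDiff _) (FiberBundle.contMDiffAt_extend ..)⟩

/-- The vector field `π(α, ·)`: its pairing with `β` is `π(α, β)`. -/
noncomputable def Bivector.sharp (π : Bivector E M) (α : OneForm E M) : SmoothVectorField E M :=
  ⟨fun x => (exists_vector_of_bidual x (π.form x (α x))).choose,
   fun x => contMDiffAt_vector fun T hT => by
    have := ContMDiffAt.clm_bundle_apply₂ (π.form.contMDiff x) (α.contMDiff x) hT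
    simp only [Bundle.contMDiffAt_totalSpace] at this
    refine this.2.congr_of_eventuallyEq (Filter.Eventually.of_forall fun y => ?_)
    exact (exists_vector_of_bidual y (π.form y (α y))).choose_spec _⟩

theorem Bivector.pair_sharp (π : Bivector E M) (α β : OneForm E M) :
    β.pair (π.sharp α) = π.eval α β := by
  ext x
  exact (exists_vector_of_bidual x (π.form x (α x))).choose_spec (β x)

theorem tensorialAt_lieDerivForm (X : SmoothVectorField E M) (β : OneForm E M) (x : M) :
    TensorialAt 𝓘(ℝ, E) E (fun W : (Π x : M, TangentSpace 𝓘(ℝ, E) x) =>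
      mvfderiv 𝓘(ℝ, E) (fun y => (β y (W y) : ℝ)) x (X x)
        - (β x (VectorField.mlieBracket 𝓘(ℝ, E) X W x) : ℝ)) x where
  smul {f W} hf hW := by
    have hβ : MDifferentiableAt 𝓘(ℝ, E) 𝓘(ℝ, ℝ) (fun y => (β y (W y) : ℝ)) x := by
      have := MDifferentiableAt.clm_bundle_apply β.mdifferentiableAt hW
      rw [mdifferentiableAt_totalSpace] at this
      exact this.2
    have h1 : (fun y => (β y ((f • W) y) : ℝ)) = f * fun y => (β y (W y) : ℝ) := by
      ext y; simp
    have h2 := VectorField.mlieBracket_smul_right (V := X) hf hW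
    rw [h1, mvfderiv_mul hf hβ, h2]
    simp
    ring
  add {W W'} hW hW' := by
    have hβ {W : Π x : M, TangentSpace 𝓘(ℝ, E) x} (hW : MDifferentiableAt 𝓘(ℝ, E)
        (𝓘(ℝ, E).prod 𝓘(ℝ, E)) (fun y => TotalSpace.mk' E y (W y)) x) :
        MDifferentiableAt 𝓘(ℝ, E) 𝓘(ℝ, ℝ) (fun y => (β y (W y) : ℝ)) x := by
      have := MDifferentiableAt.clm_bundle_apply β.mdifferentiableAt hW
      rw [mdifferentiableAt_totalSpace] at this
      exact this.2
    have h1 : (fun y => (β y ((W + W') y) : ℝ)) =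
        (fun y => (β y (W y) : ℝ)) + fun y => (β y (W' y) : ℝ) := by
      ext y; simp
    have h2 := VectorField.mlieBracket_add_right (V := X) hW hW'
    rw [h1, mvfderiv_add (hβ hW) (hβ hW'), h2]
    simp
    ring

/-- The Lie derivative `L_X β`: the 1-form with `(L_X β)(W) = X(β(W)) - β([X, W])`
for all local vector fields `W`; the right hand side is tensorial in `W`. -/
noncomputable def lieDerivForm (X : SmoothVectorField E M) (β : OneForm E M) : OneForm E M :=
  ⟨fun x => TensorialAt.mkHom _ x (tensorialAt_lieDerivForm X β x), fun x => by
    refine contMDiffAt_covector fun w => ?_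
    let t := trivializationAt E (TangentSpace 𝓘(ℝ, E) : M → Type _) x
    have hx : x ∈ t.baseSet := FiberBundle.mem_baseSet_trivializationAt' x
    have hW := FiberBundle.contMDiffAt_extend (k := ∞) 𝓘(ℝ, E) E w
    have h1 := contMDiffAt_mvfderiv (contMDiffAt_pair (β.contMDiff x) hW) (X.contMDiff x)
    have : IsManifold 𝓘(ℝ, E) (minSmoothness ℝ 2) M := by
      rw [minSmoothness_of_isRCLikeNormedField]
      infer_instance
    have : IsManifold 𝓘(ℝ, E) (((⊤ : ℕ∞) : WithTop ℕ∞) + 1) M :=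
      inferInstanceAs (IsManifold 𝓘(ℝ, E) ∞ M)
    have h2 := contMDiffAt_pair (β.contMDiff x)
      (ContMDiffAt.mlieBracket_vectorField (m := ⊤) (n := ⊤) (X.contMDiff x) hW (by simp))
    refine (h1.sub h2).congr_of_eventuallyEq ?_
    have h3 : ∀ᶠ y in nhds x, MDifferentiableAt 𝓘(ℝ, E) (𝓘(ℝ, E).prod 𝓘(ℝ, E))
        (fun y => TotalSpace.mk' E y (FiberBundle.extend E w y)) y := by
      obtain ⟨s, hs, hd⟩ := FiberBundle.exists_mdifferentiableOn_extend 𝓘(ℝ, E) E w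
      filter_upwards [eventually_eventually_nhds.2 hs] with y hy
      exact (hd y (mem_of_mem_nhds hy)).mdifferentiableAt hy
    filter_upwards [h3] with y hy
    exact TensorialAt.mkHom_apply (tensorialAt_lieDerivForm X β y) hy⟩

theorem lieDerivForm_apply (X : SmoothVectorField E M) (β : OneForm E M)
    {W : Π x : M, TangentSpace 𝓘(ℝ, E) x} {x : M}
    (hW : MDifferentiableAt 𝓘(ℝ, E) (𝓘(ℝ, E).prod 𝓘(ℝ, E))
      (fun y => TotalSpace.mk' E (E := (TangentSpace 𝓘(ℝ, E) : M → Type _)) y (W y)) x) :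
    lieDerivForm X β x (W x) = mvfderiv 𝓘(ℝ, E) (fun y => (β y (W y) : ℝ)) x (X x)
        - (β x (VectorField.mlieBracket 𝓘(ℝ, E) X W x) : ℝ) :=
  TensorialAt.mkHom_apply (tensorialAt_lieDerivForm X β x) hW

/-- The Lie derivative `L_v π`, evaluated on 1-forms:
`(L_v π)(α, β) = v(π(α, β)) - π(L_v α, β) - π(α, L_v β)`. -/
noncomputable def lieDerivBivector (v : SmoothVectorField E M) (π : Bivector E M)
    (α β : OneForm E M) : SmoothFunction E M :=
  (differential (π.eval α β)).pair v - π.eval (lieDerivForm v α) β - π.eval α (lieDerivForm v β)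

/-- The bracket `{f, g} = π(df, dg)`. -/
noncomputable def Bivector.bracket (π : Bivector E M) (f g : SmoothFunction E M) :
    SmoothFunction E M :=
  π.eval (differential f) (differential g)

/-- `π` is a Poisson tensor: `{·, ·}` satisfies the Jacobi identity. -/
def Bivector.IsPoisson (π : Bivector E M) : Prop :=
  ∀ f g h : SmoothFunction E M,
    π.bracket (π.bracket f g) h + π.bracket (π.bracket h f) g + π.bracket (π.bracket g h) f = 0

/-- `c` is a Casimir function of `π`. -/
def Bivector.IsCasimir (π : Bivector E M) (c : SmoothFunction E M) : Prop :=
  ∀ f : SmoothFunction E M, π.bracket c f = 0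

end Operations

section LieAlgebroid

variable (E : Type*) [NormedAddCommGroup E] [NormedSpace ℝ E]
  {M : Type*} [TopologicalSpace M] [ChartedSpace E M] [IsManifold 𝓘(ℝ, E) ∞ M]
  (F : Type*) [NormedAddCommGroup F] [NormedSpace ℝ F]
  (V : M → Type*) [TopologicalSpace (TotalSpace F V)] [∀ x, TopologicalSpace (V x)]
  [∀ x, AddCommGroup (V x)] [∀ x, Module ℝ (V x)] [FiberBundle F V] [VectorBundle ℝ F V]
  [ContMDiffVectorBundle ∞ F V 𝓘(ℝ, E)]

/-- A Lie algebroid structure on the smooth vector bundle `V → M`. -/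
structure LieAlgebroid where
  /-- the `ℝ`-bilinear bracket on smooth sections -/
  bracket : Cₛ^∞⟮𝓘(ℝ, E); F, V⟯ →ₗ[ℝ] Cₛ^∞⟮𝓘(ℝ, E); F, V⟯ →ₗ[ℝ] Cₛ^∞⟮𝓘(ℝ, E); F, V⟯
  /-- the anchor, a smooth vector bundle map `V → TM` over the identity -/
  anchor : Cₛ^∞⟮𝓘(ℝ, E); F →L[ℝ] E, (fun x : M => V x →L[ℝ] TangentSpace 𝓘(ℝ, E) x)⟯
  bracket_self : ∀ s, bracket s s = 0
  jacobi : ∀ s t u,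
    bracket (bracket s t) u + bracket (bracket t u) s + bracket (bracket u s) t = 0
  leibniz : ∀ s t (f : SmoothFunction E M) (x : M), bracket s (f • t) x =
    f x • bracket s t x + mvfderiv 𝓘(ℝ, E) f x (anchor x (s x)) • t x
  anchor_bracket : ∀ s t (x : M), anchor x (bracket s t x) =
    VectorField.mlieBracket 𝓘(ℝ, E) (fun y => anchor y (s y)) (fun y => anchor y (t y)) x

end LieAlgebroid

end PoissonGeometry

/-!
The bracket and the anchor satisfy the Leibniz rule `[α, fβ] = f [α, β] + a(α)(f) β`, by the product
rules for the Lie derivative of 1-forms (`bracketForm_smul`). For an alternating bracket with such a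
Leibniz rule, the defect `a([α, β]) - [a(α), a(β)]` is linear over smooth functions in each argument
(`anchorCurvature_smul_right`), and once this defect vanishes, so is the Jacobiator
(`jacobiator_smul_right`). On a Hausdorff manifold a function-linear map on 1-forms is zero as soon
as it kills all exact forms `df` (`eq_zero_of_differential`): a bump function `ψ` with `ψ x = 1`
makes `ψ α` a combination of differentials of globally defined functions (`exists_bump_frame`).
Both identities therefore only have to be checked on exact forms.

There the bracket is `[df, dg] = d{f, g} + c (v(g) d(v(f)) - v(f) d(v(g)))` and the anchor is
`a(df)(h) = {f, h} - c v(f) v(h)`. The two identities become polynomial identities in iterated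
Poisson brackets and `v`-derivatives (`anchorCurvature_differential`, `jacobiator_differential`).
They follow from the Jacobi identity for `{·, ·}`, from `{f, c} = 0`, and from
`v({f, g}) = {v(f), g} + {f, v(g)}`, which is `L_v π = 0` on exact forms. The derivative `v(c)` need
not vanish: its contributions cancel in the cyclic sum.

To pass between vector fields and derivations, one needs `df([V, W]) = V(W(f)) - W(V(f))` for the
Lie bracket of vector fields on a manifold (`mvfderiv_mlieBracket`), which reduces in a chart to the
symmetry of the second derivative.
-/

open scoped Topology

namespace PoissonGeometry

/-! ### The Lie bracket of vector fields acting on functions -/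

section

variable {E : Type*} [NormedAddCommGroup E] [NormedSpace ℝ E]
  {M : Type*} [TopologicalSpace M] [ChartedSpace E M] [IsManifold 𝓘(ℝ, E) ∞ M]

/-- In the chart at `x`, the derivative of `h` along the chart representative of `V` represents
`V(h)`. -/
theorem fderiv_comp_extChartAt_symm_mpullback {h : M → ℝ} {x : M} {z : E}
    (hz : z ∈ (extChartAt 𝓘(ℝ, E) x).target)
    (hh : MDifferentiableAt 𝓘(ℝ, E) 𝓘(ℝ, ℝ) h ((extChartAt 𝓘(ℝ, E) x).symm z))
    (V : Π y : M, TangentSpace 𝓘(ℝ, E) y) :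
    fderiv ℝ (h ∘ (extChartAt 𝓘(ℝ, E) x).symm) z
      (VectorField.mpullbackWithin 𝓘(ℝ, E) 𝓘(ℝ, E) (extChartAt 𝓘(ℝ, E) x).symm V Set.univ z) =
    mvfderiv 𝓘(ℝ, E) h ((extChartAt 𝓘(ℝ, E) x).symm z) (V ((extChartAt 𝓘(ℝ, E) x).symm z)) := by
  have hi := isInvertible_mfderivWithin_extChartAt_symm (I := 𝓘(ℝ, E)) (x := x) hz
  have hs := mdifferentiableWithinAt_extChartAt_symm (I := 𝓘(ℝ, E)) hz
  simp only [modelWithCornersSelf_coe, Set.range_id, mfderivWithin_univ,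
    mdifferentiableWithinAt_univ] at hi hs
  have hc := mfderiv_comp z hh hs
  rw [mfderiv_eq_fderiv] at hc
  rw [hc, VectorField.mpullbackWithin_apply, mfderivWithin_univ]
  change mfderiv 𝓘(ℝ, E) 𝓘(ℝ, ℝ) h ((extChartAt 𝓘(ℝ, E) x).symm z)
    ((mfderiv 𝓘(ℝ, E) 𝓘(ℝ, E) (extChartAt 𝓘(ℝ, E) x).symm z)
      ((mfderiv 𝓘(ℝ, E) 𝓘(ℝ, E) (extChartAt 𝓘(ℝ, E) x).symm z).inverse _)) = _
  rw [hi.self_apply_inverse]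
  rfl

/-- `df([V, W]) = V(W(f)) - W(V(f))`. Local smoothness of the vector fields is enough, so this
applies to `FiberBundle.extend`. -/
theorem mvfderiv_mlieBracket [CompleteSpace E] {f : M → ℝ}
    {V W : Π y : M, TangentSpace 𝓘(ℝ, E) y} {x : M}
    (hf : ContMDiff 𝓘(ℝ, E) 𝓘(ℝ, ℝ) ∞ f)
    (hV : ContMDiffAt 𝓘(ℝ, E) (𝓘(ℝ, E).prod 𝓘(ℝ, E)) ∞
      (fun y => TotalSpace.mk' E (E := (TangentSpace 𝓘(ℝ, E) : M → Type _)) y (V y)) x)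
    (hW : ContMDiffAt 𝓘(ℝ, E) (𝓘(ℝ, E).prod 𝓘(ℝ, E)) ∞
      (fun y => TotalSpace.mk' E (E := (TangentSpace 𝓘(ℝ, E) : M → Type _)) y (W y)) x) :
    mvfderiv 𝓘(ℝ, E) f x (VectorField.mlieBracket 𝓘(ℝ, E) V W x) =
      mvfderiv 𝓘(ℝ, E) (fun y => mvfderiv 𝓘(ℝ, E) f y (W y)) x (V x) -
        mvfderiv 𝓘(ℝ, E) (fun y => mvfderiv 𝓘(ℝ, E) f y (V y)) x (W x) := by
  have : IsManifold 𝓘(ℝ, E) 2 M := .of_le (n := ∞) (by norm_cast)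
  set φ := extChartAt 𝓘(ℝ, E) x with hφ
  have hx : φ.symm (φ x) = x := extChartAt_to_inv x
  have hmem : φ x ∈ φ.target := mem_extChartAt_target x
  have hd {h : M → ℝ} (V : Π y : M, TangentSpace 𝓘(ℝ, E) y)
      (hh : ContMDiffAt 𝓘(ℝ, E) 𝓘(ℝ, ℝ) ∞ h x) :=
    fderiv_comp_extChartAt_symm_mpullback hmem
      (by rw [← hφ, hx]; exact hh.mdifferentiableAt (by simp)) V
  have hg : ContDiffAt ℝ ∞ (f ∘ φ.symm) (φ x) := by
    have h1 : ContMDiffAt 𝓘(ℝ, E) 𝓘(ℝ, E) ∞ φ.symm (φ x) :=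
      (contMDiffOn_extChartAt_symm x).contMDiffAt (extChartAt_target_mem_nhds x)
    exact (hf.contMDiffAt.comp _ h1).contDiffAt
  have hdiff {V : Π y : M, TangentSpace 𝓘(ℝ, E) y}
      (hV : ContMDiffAt 𝓘(ℝ, E) (𝓘(ℝ, E).prod 𝓘(ℝ, E)) ∞
      (fun y => TotalSpace.mk' E (E := (TangentSpace 𝓘(ℝ, E) : M → Type _)) y (V y)) x) :
      DifferentiableAt ℝ (VectorField.mpullbackWithin 𝓘(ℝ, E) 𝓘(ℝ, E) φ.symm V Set.univ)
        (φ x) := by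
    have := (hV.mdifferentiableAt (by simp)).mdifferentiableWithinAt (s := Set.univ)
      |>.differentiableWithinAt_mpullbackWithin_vectorField
    simp only [modelWithCornersSelf_coe, Set.range_id, Set.preimage_univ, Set.univ_inter] at this
    exact differentiableWithinAt_univ.mp this
  have hb : mvfderiv 𝓘(ℝ, E) f x (VectorField.mlieBracket 𝓘(ℝ, E) V W x) =
      fderiv ℝ (f ∘ φ.symm) (φ x) (VectorField.lieBracket ℝ
        (VectorField.mpullbackWithin 𝓘(ℝ, E) 𝓘(ℝ, E) φ.symm V Set.univ)
        (VectorField.mpullbackWithin 𝓘(ℝ, E) 𝓘(ℝ, E) φ.symm W Set.univ) (φ x)) := by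
    have hi := isInvertible_mfderiv_extChartAt (I := 𝓘(ℝ, E))
      (mem_extChartAt_source (I := 𝓘(ℝ, E)) x)
    have h1 : mvfderiv 𝓘(ℝ, E) f x =
        (mvfderiv 𝓘(ℝ, E) (f ∘ φ.symm) (φ x)).comp (mfderiv 𝓘(ℝ, E) 𝓘(ℝ, E) φ x) := by
      have h2 : f =ᶠ[𝓝 x] (f ∘ φ.symm) ∘ φ := by
        filter_upwards [extChartAt_source_mem_nhds (I := 𝓘(ℝ, E)) x] with y hy
        exact congrArg f (φ.left_inv hy).symm
      rw [← mvfderiv_comp x (hg.contMDiffAt.mdifferentiableAt (by simp))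
        (mdifferentiableAt_extChartAt (mem_chart_source E x))]
      ext w
      change mfderiv 𝓘(ℝ, E) 𝓘(ℝ, ℝ) f x w =
        mfderiv 𝓘(ℝ, E) 𝓘(ℝ, ℝ) ((f ∘ φ.symm) ∘ φ) x w
      rw [h2.mfderiv_eq]
      rfl
    have h2 : mfderiv 𝓘(ℝ, E) 𝓘(ℝ, E) φ x (VectorField.mlieBracket 𝓘(ℝ, E) V W x) =
        VectorField.lieBracket ℝ
          (VectorField.mpullbackWithin 𝓘(ℝ, E) 𝓘(ℝ, E) φ.symm V Set.univ)
          (VectorField.mpullbackWithin 𝓘(ℝ, E) 𝓘(ℝ, E) φ.symm W Set.univ) (φ x) := by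
      refine (hi.self_apply_inverse _).trans ?_
      simp only [modelWithCornersSelf_coe, Set.range_id, Set.preimage_univ, Set.univ_inter]
      exact congrFun (VectorField.lieBracketWithin_univ (E := E)) _
    rw [h1, ContinuousLinearMap.comp_apply, h2, mvfderiv, mfderiv_eq_fderiv]
    rfl
  have heq (V : Π y : M, TangentSpace 𝓘(ℝ, E) y) :
      (fun z => fderiv ℝ (f ∘ φ.symm) z
        (VectorField.mpullbackWithin 𝓘(ℝ, E) 𝓘(ℝ, E) φ.symm V Set.univ z)) =ᶠ[𝓝 (φ x)]
      (fun y => mvfderiv 𝓘(ℝ, E) f y (V y)) ∘ φ.symm := by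
    filter_upwards [extChartAt_target_mem_nhds x] with z hz
    exact fderiv_comp_extChartAt_symm_mpullback hz (hf.mdifferentiableAt (by simp)) V
  rw [hb, VectorField.fderiv_apply_lieBracket hg (by simp; norm_cast) (hdiff hW) (hdiff hV),
    (heq V).fderiv_eq, (heq W).fderiv_eq, hd _ (contMDiffAt_mvfderiv hf.contMDiffAt hW),
    hd _ (contMDiffAt_mvfderiv hf.contMDiffAt hV), ← hφ, hx]

end

/-! ### Sections as a module over smooth functions, and global frames near a point -/

section

section SectionModule

variable {E : Type*} [NormedAddCommGroup E] [NormedSpace ℝ E]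
  {M : Type*} [TopologicalSpace M] [ChartedSpace E M]
  {F : Type*} [NormedAddCommGroup F] [NormedSpace ℝ F]
  {V : M → Type*} [TopologicalSpace (TotalSpace F V)] [∀ x, TopologicalSpace (V x)]
  [∀ x, AddCommGroup (V x)] [∀ x, Module ℝ (V x)] [FiberBundle F V] [VectorBundle ℝ F V]

/-- Smooth sections form a module over smooth functions. Its scalar multiplication is the pointwise
product `coe_fun_smul`. -/
noncomputable instance : Module C^∞⟮𝓘(ℝ, E), M; ℝ⟯ Cₛ^∞⟮𝓘(ℝ, E); F, V⟯ where
  one_smul s := by ext x; exact one_smul ℝ (s x)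
  mul_smul f g s := by ext x; exact mul_smul (f x) (g x) (s x)
  smul_zero f := by ext x; exact smul_zero (f x)
  smul_add f s t := by ext x; exact smul_add (f x) (s x) (t x)
  add_smul f g s := by ext x; exact add_smul (f x) (g x) (s x)
  zero_smul s := by ext x; exact zero_smul ℝ (s x)

theorem section_add_apply (s t : Cₛ^∞⟮𝓘(ℝ, E); F, V⟯) (x : M) :
    (s + t) x = s x + t x := rfl

theorem section_sub_apply (s t : Cₛ^∞⟮𝓘(ℝ, E); F, V⟯) (x : M) :
    (s - t) x = s x - t x := by simp

theorem section_sum_apply {ι : Type*} (S : Finset ι) (s : ι → Cₛ^∞⟮𝓘(ℝ, E); F, V⟯) (x : M) :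
    (∑ i ∈ S, s i) x = ∑ i ∈ S, s i x := by
  rw [← ContMDiffSection.coeAddHom_apply, map_sum, Finset.sum_apply]
  rfl

end SectionModule

variable {E : Type*} [NormedAddCommGroup E] [NormedSpace ℝ E] [FiniteDimensional ℝ E]
  {M : Type*} [TopologicalSpace M] [ChartedSpace E M] [IsManifold 𝓘(ℝ, E) ∞ M]

/-- A coordinate frame cut off by bump functions: `X i` are the coordinate vector fields times `ψ`,
and `g i` are globally smooth functions that agree with the coordinates on the support of `ψ`. -/
theorem exists_bump_frame [T2Space M] (x : M) :
    ∃ (ψ : SmoothFunction E M) (X : Fin (Module.finrank ℝ E) → SmoothVectorField E M)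
      (g : Fin (Module.finrank ℝ E) → SmoothFunction E M), ψ x = 1 ∧
      ∀ (y : M) (w : TangentSpace 𝓘(ℝ, E) y), ψ y • w = ∑ i, differential (g i) y w • X i y := by
  let b := Module.finBasis ℝ E
  let e := trivializationAt E (TangentSpace 𝓘(ℝ, E) : M → Type _) x
  let φ := extChartAt 𝓘(ℝ, E) x
  obtain ⟨χ⟩ : Nonempty (SmoothBumpFunction 𝓘(ℝ, E) x) := inferInstance
  obtain ⟨U, hU, hUo, hxU⟩ := eventually_nhds_iff.1 χ.eventuallyEq_one
  obtain ⟨ψ, -, hψ⟩ := (SmoothBumpFunction.nhds_basis_tsupport (I := 𝓘(ℝ, E)) x).mem_iff.1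
    (Filter.inter_mem (hUo.mem_nhds hxU) (e.open_baseSet.mem_nhds
      (FiberBundle.mem_baseSet_trivializationAt' x)))
  let ℓ (i) : E →L[ℝ] ℝ := LinearMap.toContinuousLinearMap (b.coord i)
  refine ⟨⟨ψ, ψ.contMDiff⟩, fun i => ⟨(ψ : M → ℝ) • e.localFrame b i,
    ContMDiffOn.smul_section_of_tsupport ψ.contMDiff.contMDiffOn e.open_baseSet
      (hψ.trans Set.inter_subset_right) (e.contMDiffOn_localFrame_baseSet _ b i)⟩,
    fun i => ⟨fun y => χ y • ℓ i (φ y), χ.contMDiff_smul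
      ((ℓ i).contMDiff.comp_contMDiffOn contMDiffOn_extChartAt)⟩, ψ.eq_one, fun y w => ?_⟩
  -- `χ = 1` on a neighbourhood of `tsupport ψ`, so that there `g i` is the coordinate itself.
  by_cases hy : y ∈ tsupport ψ
  swap
  · have : ψ y = 0 := image_eq_zero_of_notMem_tsupport hy
    simp [this]
  obtain ⟨hyU, hye⟩ := hψ hy
  have hys : y ∈ (chartAt E x).source := by simpa [e] using hye
  have hd (i) : mvfderiv 𝓘(ℝ, E) (fun y => χ y • ℓ i (φ y)) y w =
      b.coord i (e.continuousLinearMapAt ℝ y w) := by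
    have h1 : (fun y => χ y • ℓ i (φ y)) =ᶠ[𝓝 y] ℓ i ∘ φ := by
      filter_upwards [hUo.mem_nhds hyU] with z hz
      simp [hU z hz]
    have h2 : mfderiv 𝓘(ℝ, E) 𝓘(ℝ, ℝ) (fun y => χ y • ℓ i (φ y)) y w =
        mfderiv 𝓘(ℝ, E) 𝓘(ℝ, ℝ) (ℓ i ∘ φ) y w := by rw [h1.mfderiv_eq]; rfl
    refine h2.trans ?_
    rw [mfderiv_comp y (ℓ i).mdifferentiableAt (mdifferentiableAt_extChartAt hys),
      (ℓ i).mfderiv_eq, ← TangentBundle.continuousLinearMapAt_trivializationAt hys]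
    rfl
  have hw : w = ∑ i, b.coord i (e.continuousLinearMapAt ℝ y w) • e.localFrame b i y := by
    have := (e.basisAt b hye).sum_repr w
    conv_lhs => rw [← this]
    refine Finset.sum_congr rfl fun i _ => ?_
    rw [e.localFrame_apply_of_mem_baseSet b hye]
    simp [Bundle.Trivialization.basisAt, hye]
  change ψ y • w = ∑ i, (mvfderiv 𝓘(ℝ, E) (fun y => χ y • ℓ i (φ y)) y w) •
    (ψ y • e.localFrame b i y)
  simp_rw [hd, smul_comm _ (ψ y), ← Finset.smul_sum]
  rw [← hw]

end

/-! ### Tensoriality of the anchor defect and of the Jacobiator -/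

section Algebra

variable {R Γ : Type*} [CommRing R] [Algebra ℝ R] [AddCommGroup Γ] [Module ℝ Γ] [Module R Γ]
  (B : Γ →ₗ[ℝ] Γ →ₗ[ℝ] Γ) (a : Γ →ₗ[R] Derivation ℝ R R)

/-- The defect of `a` as a bracket homomorphism. -/
def anchorCurvature (s t : Γ) : Derivation ℝ R R := a (B s t) - ⁅a s, a t⁆

/-- The cyclic sum whose vanishing is the Jacobi identity. -/
def jacobiator (s t u : Γ) : Γ := B (B s t) u + B (B t u) s + B (B u s) t

variable {B a}

theorem jacobiator_rotate (s t u : Γ) : jacobiator B s t u = jacobiator B t u s := by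
  unfold jacobiator; abel

theorem anchorCurvature_smul_right (leibniz : ∀ s t (f : R), B s (f • t) = f • B s t + a s f • t)
    (s t : Γ) (f : R) : anchorCurvature B a s (f • t) = f • anchorCurvature B a s t := by
  ext h
  simp [anchorCurvature, leibniz, Derivation.commutator_apply]
  ring

theorem swap_of_alternating (self : ∀ s, B s s = 0) (s t : Γ) : B s t = -B t s := by
  have := self (s + t)
  simp only [map_add, LinearMap.add_apply, self, zero_add, add_zero] at this
  exact eq_neg_of_add_eq_zero_right this

theorem jacobiator_smul_right (self : ∀ s, B s s = 0)
    (leibniz : ∀ s t (f : R), B s (f • t) = f • B s t + a s f • t)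
    (anchor : ∀ s t, a (B s t) = ⁅a s, a t⁆) (s t u : Γ) (f : R) :
    jacobiator B s t (f • u) = f • jacobiator B s t u := by
  unfold jacobiator
  have swap := swap_of_alternating self
  rw [swap (f • u) s, swap (B t (f • u)) s, map_neg, LinearMap.neg_apply,
    swap (B s (f • u)) t, swap (B t u) s, swap u s, map_neg, LinearMap.neg_apply,
    swap (B s u) t]
  simp only [leibniz, map_add, anchor, Derivation.commutator_apply, sub_smul, smul_add, smul_neg]
  abel

end Algebra

/-! ### Detection on exact forms -/

section

variable {E : Type*} [NormedAddCommGroup E] [NormedSpace ℝ E] [FiniteDimensional ℝ E]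
  {M : Type*} [TopologicalSpace M] [ChartedSpace E M] [IsManifold 𝓘(ℝ, E) ∞ M]

/-- Global functions separate tangent vectors. -/
theorem tangent_ext [T2Space M] {x : M} {u w : TangentSpace 𝓘(ℝ, E) x}
    (h : ∀ g : SmoothFunction E M, differential g x u = differential g x w) : u = w := by
  obtain ⟨ψ, X, g, hψ, hX⟩ := exists_bump_frame (E := E) x
  have hu := hX x u
  have hw := hX x w
  rw [hψ, one_smul] at hu hw
  rw [hu, hw]
  simp only [h]

theorem exists_vectorField_apply_eq [T2Space M] {x : M} (w : TangentSpace 𝓘(ℝ, E) x) :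
    ∃ W : SmoothVectorField E M, W x = w := by
  obtain ⟨ψ, X, g, hψ, hX⟩ := exists_bump_frame (E := E) x
  refine ⟨∑ i, (differential (g i) x w : ℝ) • X i, ?_⟩
  have hw := hX x w
  rw [hψ, one_smul] at hw
  conv_rhs => rw [hw]
  exact section_sum_apply _ _ x

omit [FiniteDimensional ℝ E] in
theorem oneForm_ext {α β : OneForm E M}
    (h : ∀ x (w : TangentSpace 𝓘(ℝ, E) x), (α x w : ℝ) = β x w) : α = β := by
  ext x : 1
  exact ContinuousLinearMap.ext (h x)

/-- A map on 1-forms that is linear over smooth functions vanishes if it vanishes on exact forms. -/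
theorem eq_zero_of_differential [T2Space M] {T : OneForm E M → SmoothFunction E M}
    (hadd : ∀ α β, T (α + β) = T α + T β)
    (hsmul : ∀ (f : SmoothFunction E M) α, T (f • α) = f * T α)
    (hd : ∀ f, T (differential f) = 0) (α : OneForm E M) : T α = 0 := by
  ext x
  obtain ⟨ψ, X, g, hψ, hX⟩ := exists_bump_frame (E := E) x
  have hα : ψ • α = ∑ i, α.pair (X i) • differential (g i) := by
    refine oneForm_ext fun y w => ?_
    have h1 := congrArg (α y) (hX y w)
    rw [map_smul, map_sum] at h1
    refine h1.trans ?_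
    rw [section_sum_apply, sum_apply]
    refine Finset.sum_congr rfl fun i _ => ?_
    rw [map_smul]
    exact mul_comm _ _
  let T' : OneForm E M →ₗ[SmoothFunction E M] SmoothFunction E M :=
    { toFun := T, map_add' := hadd, map_smul' := hsmul }
  have h0 : T' (ψ • α) = 0 := by
    rw [hα, map_sum]
    refine Finset.sum_eq_zero fun i _ => ?_
    rw [map_smul]
    exact (congrArg _ (hd _)).trans (smul_zero _)
  have h1 := congrArg (fun F : SmoothFunction E M => F x) (h0.symm.trans (hsmul ψ α))
  change (0 : ℝ) = ψ x * T α x at h1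
  rw [hψ, one_mul] at h1
  exact h1.symm

end

/-! ### Lie derivatives of 1-forms -/

section

variable {E : Type*} [NormedAddCommGroup E] [NormedSpace ℝ E] [FiniteDimensional ℝ E]
  {M : Type*} [TopologicalSpace M] [ChartedSpace E M] [IsManifold 𝓘(ℝ, E) ∞ M]

omit [FiniteDimensional ℝ E] [IsManifold 𝓘(ℝ, E) ∞ M] in
theorem smoothFunction_mdifferentiableAt (f : SmoothFunction E M) (x : M) :
    MDifferentiableAt 𝓘(ℝ, E) 𝓘(ℝ, ℝ) f x := f.contMDiff.mdifferentiableAt (by simp)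

theorem differential_add (f g : SmoothFunction E M) :
    differential (f + g) = differential f + differential g := by
  refine oneForm_ext fun x w => ?_
  exact DFunLike.congr_fun (mvfderiv_add (smoothFunction_mdifferentiableAt f x)
    (smoothFunction_mdifferentiableAt g x)) w

theorem differential_mul (f g : SmoothFunction E M) :
    differential (f * g) = f • differential g + g • differential f := by
  refine oneForm_ext fun x w => ?_
  exact DFunLike.congr_fun (mvfderiv_mul (smoothFunction_mdifferentiableAt f x)
    (smoothFunction_mdifferentiableAt g x)) w

theorem differential_algebraMap (r : ℝ) :
    differential (algebraMap ℝ (SmoothFunction E M) r) = 0 := by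
  refine oneForm_ext fun x w => ?_
  exact DFunLike.congr_fun (mvfderiv_const (I := 𝓘(ℝ, E)) r) w

omit [FiniteDimensional ℝ E] in
theorem algebraMap_smul_oneForm (r : ℝ) (α : OneForm E M) :
    algebraMap ℝ (SmoothFunction E M) r • α = r • α := by
  refine oneForm_ext fun x w => ?_
  rfl

theorem differential_real_smul (r : ℝ) (f : SmoothFunction E M) :
    differential (r • f) = r • differential f := by
  rw [Algebra.smul_def, differential_mul, differential_algebraMap, smul_zero, add_zero,
    algebraMap_smul_oneForm]

/-- The derivation `f ↦ X(f)` given by a vector field `X`. -/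
noncomputable def vectorFieldDerivation :
    SmoothVectorField E M →ₗ[SmoothFunction E M]
      Derivation ℝ (SmoothFunction E M) (SmoothFunction E M) where
  toFun X := Derivation.mk'
    { toFun := fun f => (differential f).pair X
      map_add' := fun f g => by rw [differential_add]; rfl
      map_smul' := fun r f => by rw [differential_real_smul]; rfl }
    fun f g => by
      change (differential (f * g)).pair X = _
      rw [differential_mul]; rfl
  map_add' X Y := by
    ext f x
    exact (differential f x).map_add _ _
  map_smul' h X := by
    ext f x
    exact (differential f x).map_smul _ _

theorem vectorFieldDerivation_apply (X : SmoothVectorField E M) (f : SmoothFunction E M) :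
    vectorFieldDerivation X f = (differential f).pair X := rfl

theorem differential_mlieBracket (X Y : SmoothVectorField E M) (f : SmoothFunction E M) (x : M) :
    differential f x (VectorField.mlieBracket 𝓘(ℝ, E) X Y x) =
      ⁅vectorFieldDerivation X, vectorFieldDerivation Y⁆ f x :=
  mvfderiv_mlieBracket f.contMDiff X.contMDiff.contMDiffAt Y.contMDiff.contMDiffAt

/-- The defining formula of `L_X β` on the tangent vector `w`, with `w` extended to a local vector
field. -/
theorem lieDerivForm_apply_extend (X : SmoothVectorField E M) (β : OneForm E M) (x : M)
    (w : TangentSpace 𝓘(ℝ, E) x) :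
    (lieDerivForm X β x w : ℝ) =
      mvfderiv 𝓘(ℝ, E) (fun y => (β y (FiberBundle.extend E w y) : ℝ)) x (X x) -
        (β x (VectorField.mlieBracket 𝓘(ℝ, E) X (FiberBundle.extend E w) x) : ℝ) := by
  have := lieDerivForm_apply X β (FiberBundle.mdifferentiableAt_extend 𝓘(ℝ, E) E w)
  rwa [FiberBundle.extend_apply_self] at this

omit [FiniteDimensional ℝ E] in
theorem mdifferentiableAt_pair_extend (β : OneForm E M) {x : M} (w : TangentSpace 𝓘(ℝ, E) x) :
    MDifferentiableAt 𝓘(ℝ, E) 𝓘(ℝ, ℝ) (fun y => (β y (FiberBundle.extend E w y) : ℝ)) x :=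
  (contMDiffAt_pair (β.contMDiff x)
    (FiberBundle.contMDiffAt_extend (k := ∞) 𝓘(ℝ, E) E w)).mdifferentiableAt (by simp)

/-- Lie derivatives commute with the differential on functions. -/
theorem lieDerivForm_differential (X : SmoothVectorField E M) (f : SmoothFunction E M) :
    lieDerivForm X (differential f) = differential (vectorFieldDerivation X f) := by
  refine oneForm_ext fun x w => ?_
  rw [lieDerivForm_apply_extend]
  have := mvfderiv_mlieBracket f.contMDiff (X.contMDiff x)
    (FiberBundle.contMDiffAt_extend (k := ∞) 𝓘(ℝ, E) E w)
  rw [FiberBundle.extend_apply_self] at this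
  refine (congrArg₂ (· - ·) rfl this).trans ?_
  exact sub_sub_cancel _ _

theorem lieDerivForm_smul (X : SmoothVectorField E M) (f : SmoothFunction E M) (β : OneForm E M) :
    lieDerivForm X (f • β) = f • lieDerivForm X β + vectorFieldDerivation X f • β := by
  refine oneForm_ext fun x w => ?_
  have h1 := DFunLike.congr_fun (mvfderiv_mul (smoothFunction_mdifferentiableAt f x)
    (mdifferentiableAt_pair_extend β w)) (X x)
  have h2 := lieDerivForm_apply_extend X β x w
  rw [lieDerivForm_apply_extend]
  change mvfderiv 𝓘(ℝ, E)
      ((f : M → ℝ) * fun y => (β y (FiberBundle.extend E w y) : ℝ) : M → ℝ) x (X x) -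
    f x * (β x (VectorField.mlieBracket 𝓘(ℝ, E) X (FiberBundle.extend E w) x) : ℝ) =
    f x * lieDerivForm X β x w + mvfderiv 𝓘(ℝ, E) f x (X x) * β x w
  rw [h1, h2]
  simp
  ring

theorem lieDerivForm_add (X : SmoothVectorField E M) (α β : OneForm E M) :
    lieDerivForm X (α + β) = lieDerivForm X α + lieDerivForm X β := by
  refine oneForm_ext fun x w => ?_
  have h1 := DFunLike.congr_fun (mvfderiv_add (mdifferentiableAt_pair_extend α w)
    (mdifferentiableAt_pair_extend β w)) (X x)
  rw [lieDerivForm_apply_extend]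
  refine (congrArg₂ (· - ·) h1 rfl).trans ?_
  change _ = (lieDerivForm X α x w : ℝ) + lieDerivForm X β x w
  rw [lieDerivForm_apply_extend, lieDerivForm_apply_extend]
  exact add_sub_add_comm _ _ _ _

theorem lieDerivForm_add_left (X Y : SmoothVectorField E M) (β : OneForm E M) :
    lieDerivForm (X + Y) β = lieDerivForm X β + lieDerivForm Y β := by
  refine oneForm_ext fun x w => ?_
  have h1 := VectorField.mlieBracket_add_left (W := FiberBundle.extend E w)
    (X.mdifferentiableAt (x := x)) (Y.mdifferentiableAt (x := x))
  change _ = (lieDerivForm X β x w : ℝ) + lieDerivForm Y β x w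
  simp only [lieDerivForm_apply_extend]
  rw [ContMDiffSection.coe_add, h1, map_add, Pi.add_apply, map_add]
  exact add_sub_add_comm _ _ _ _

theorem lieDerivForm_smul_left (f : SmoothFunction E M) (X : SmoothVectorField E M)
    (β : OneForm E M) :
    lieDerivForm (f • X) β = f • lieDerivForm X β + β.pair X • differential f := by
  refine oneForm_ext fun x w => ?_
  have h1 := VectorField.mlieBracket_smul_left (W := FiberBundle.extend E w)
    (smoothFunction_mdifferentiableAt f x) (X.mdifferentiableAt (x := x))
  rw [FiberBundle.extend_apply_self] at h1
  have h2 := lieDerivForm_apply_extend X β x w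
  rw [lieDerivForm_apply_extend]
  change mvfderiv 𝓘(ℝ, E) (fun y => (β y (FiberBundle.extend E w y) : ℝ)) x (f x • X x) -
    (β x (VectorField.mlieBracket 𝓘(ℝ, E) ((f : M → ℝ) • (X : Π y : M, TangentSpace 𝓘(ℝ, E) y))
      (FiberBundle.extend E w) x) : ℝ) =
    f x * lieDerivForm X β x w + β x (X x) * mvfderiv 𝓘(ℝ, E) f x w
  rw [h1, h2, map_smul, map_add, map_smul, map_smul]
  simp only [smul_eq_mul]
  ring

theorem apply_sharp (π : Bivector E M) (α : OneForm E M) (x : M) (ξ : CotangentSpace E x) :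
    ξ (π.sharp α x) = π.form x (α x) ξ :=
  (exists_vector_of_bidual x (π.form x (α x))).choose_spec ξ

/-- The map `α ↦ π(α, ·)`, linear over smooth functions. -/
noncomputable def Bivector.sharpHom [T2Space M] (π : Bivector E M) :
    OneForm E M →ₗ[SmoothFunction E M] SmoothVectorField E M where
  toFun := π.sharp
  map_add' α β := by
    ext x
    refine tangent_ext fun g => ?_
    rw [apply_sharp, section_add_apply, section_add_apply, map_add, map_add, apply_sharp,
      apply_sharp]
    rfl
  map_smul' f α := by
    ext x
    refine tangent_ext fun g => ?_
    rw [apply_sharp, RingHom.id_apply, coe_fun_smul, coe_fun_smul, map_smul, map_smul,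
      apply_sharp]
    rfl

omit [FiniteDimensional ℝ E] in
theorem Bivector.eval_swap (π : Bivector E M) (α β : OneForm E M) :
    π.eval α β = -π.eval β α := by
  ext x
  have := π.alternating x (α x + β x)
  simp only [map_add, add_apply, π.alternating, zero_add, add_zero] at this
  exact eq_neg_of_add_eq_zero_right this

end

/-! ### The bracket of 1-forms and its identities -/

section

variable {E : Type*} [NormedAddCommGroup E] [NormedSpace ℝ E] [FiniteDimensional ℝ E]
  {M : Type*} [TopologicalSpace M] [T2Space M] [ChartedSpace E M] [IsManifold 𝓘(ℝ, E) ∞ M]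

variable (π : Bivector E M) (c : SmoothFunction E M) (v : SmoothVectorField E M)

omit [T2Space M] in
theorem differential_zero : differential (0 : SmoothFunction E M) = 0 := by
  simpa using differential_real_smul 0 (0 : SmoothFunction E M)

omit [T2Space M] in
theorem differential_neg (f : SmoothFunction E M) : differential (-f) = -differential f := by
  simpa using differential_real_smul (-1) f

omit [FiniteDimensional ℝ E] [T2Space M] in
theorem Bivector.eval_add (α β γ : OneForm E M) :
    π.eval α (β + γ) = π.eval α β + π.eval α γ := by
  ext x
  exact (π.form x (α x)).map_add _ _

omit [FiniteDimensional ℝ E] [T2Space M] in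
theorem Bivector.eval_smul (α β : OneForm E M) (f : SmoothFunction E M) :
    π.eval α (f • β) = f * π.eval α β := by
  ext x
  exact (π.form x (α x)).map_smul _ _

/-- The map `α ↦ α(v)`, linear over smooth functions. -/
noncomputable def pairing : OneForm E M →ₗ[SmoothFunction E M] SmoothFunction E M where
  toFun α := α.pair v
  map_add' _ _ := rfl
  map_smul' _ _ := rfl

/-- The anchor on sections: `a(α) = π(α, ·) - c α(v) v`. -/
noncomputable def anchorField : OneForm E M →ₗ[SmoothFunction E M] SmoothVectorField E M :=
  π.sharpHom - c • (pairing v).smulRight v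

/-- The bracket `[α, β]_{c,v}` of 1-forms. -/
noncomputable def bracketForm (α β : OneForm E M) : OneForm E M :=
  lieDerivForm (π.sharp α) β - lieDerivForm (π.sharp β) α - differential (π.eval α β)
    + c • (β.pair v • lieDerivForm v α - α.pair v • lieDerivForm v β)

omit [T2Space M] in
theorem bracketForm_swap (α β : OneForm E M) :
    bracketForm π c v α β = -bracketForm π c v β α := by
  unfold bracketForm
  rw [π.eval_swap β α, differential_neg]
  module

theorem bracketForm_add (α β γ : OneForm E M) :
    bracketForm π c v α (β + γ) = bracketForm π c v α β + bracketForm π c v α γ := by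
  unfold bracketForm
  have h1 : π.sharp (β + γ) = π.sharp β + π.sharp γ := map_add π.sharpHom β γ
  have h2 : (β + γ).pair v = β.pair v + γ.pair v := rfl
  rw [h1, h2, π.eval_add, differential_add, lieDerivForm_add, lieDerivForm_add,
    lieDerivForm_add_left]
  module

theorem vectorFieldDerivation_anchorField (α : OneForm E M) (f : SmoothFunction E M) :
    vectorFieldDerivation (anchorField π c v α) f =
      vectorFieldDerivation (π.sharp α) f - c * (α.pair v * vectorFieldDerivation v f) := by
  have : anchorField π c v α = π.sharp α - c • α.pair v • v := rfl
  rw [this, map_sub, map_smul, map_smul]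
  rfl

/-- The Leibniz rule. -/
theorem bracketForm_smul (α β : OneForm E M) (f : SmoothFunction E M) :
    bracketForm π c v α (f • β) = f • bracketForm π c v α β +
      vectorFieldDerivation (anchorField π c v α) f • β := by
  unfold bracketForm
  have h1 : π.sharp (f • β) = f • π.sharp β := map_smul π.sharpHom f β
  have h2 : (f • β).pair v = f * β.pair v := rfl
  rw [h1, h2, π.eval_smul, differential_mul, lieDerivForm_smul, lieDerivForm_smul,
    lieDerivForm_smul_left, vectorFieldDerivation_anchorField, π.pair_sharp, π.eval_swap β α]
  module

theorem bracketForm_real_smul (r : ℝ) (α β : OneForm E M) :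
    bracketForm π c v α (r • β) = r • bracketForm π c v α β := by
  rw [← algebraMap_smul_oneForm, bracketForm_smul, Derivation.map_algebraMap, zero_smul, add_zero,
    algebraMap_smul_oneForm]

/-- The bracket of 1-forms as an `ℝ`-bilinear map. -/
noncomputable def bracketHom : OneForm E M →ₗ[ℝ] OneForm E M →ₗ[ℝ] OneForm E M :=
  LinearMap.mk₂ ℝ (bracketForm π c v)
    (fun α β γ => by
      rw [bracketForm_swap, bracketForm_add, neg_add, ← bracketForm_swap, ← bracketForm_swap])
    (fun r α β => by
      rw [bracketForm_swap, bracketForm_real_smul, ← smul_neg, ← bracketForm_swap])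
    (bracketForm_add π c v)
    (fun r α β => bracketForm_real_smul π c v r α β)

/-- The anchor on sections, with values in derivations of the algebra of smooth functions. -/
noncomputable def anchorDerivation : OneForm E M →ₗ[SmoothFunction E M]
    Derivation ℝ (SmoothFunction E M) (SmoothFunction E M) :=
  vectorFieldDerivation ∘ₗ anchorField π c v

theorem bracketHom_self (α : OneForm E M) : bracketHom π c v α α = 0 := by
  have h : π.eval α α = 0 := by
    ext x
    exact π.alternating x (α x)
  change bracketForm π c v α α = 0
  simp [bracketForm, h, differential_zero]

theorem bracketHom_smul (α β : OneForm E M) (f : SmoothFunction E M) :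
    bracketHom π c v α (f • β) = f • bracketHom π c v α β + anchorDerivation π c v α f • β :=
  bracketForm_smul π c v α β f

/-- The Hamiltonian derivation `g ↦ {f, g}` of a function `f`. -/
noncomputable def hamiltonian (f : SmoothFunction E M) :
    Derivation ℝ (SmoothFunction E M) (SmoothFunction E M) :=
  vectorFieldDerivation (π.sharp (differential f))

local notation "X_" => hamiltonian π

local notation "D_" => vectorFieldDerivation v

omit [T2Space M] in
theorem hamiltonian_apply (f g : SmoothFunction E M) : X_ f g = π.bracket f g :=
  π.pair_sharp _ _

omit [T2Space M] in
theorem hamiltonian_swap (f g : SmoothFunction E M) : X_ f g = -X_ g f := by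
  rw [hamiltonian_apply, hamiltonian_apply]
  exact π.eval_swap _ _

theorem anchorDerivation_differential (f h : SmoothFunction E M) :
    anchorDerivation π c v (differential f) h = X_ f h - c * (D_ f * D_ h) :=
  vectorFieldDerivation_anchorField π c v _ h

theorem bracketHom_differential (f g : SmoothFunction E M) :
    bracketHom π c v (differential f) (differential g) =
      differential (X_ f g) + c • (D_ g • differential (D_ f) - D_ f • differential (D_ g)) := by
  change bracketForm π c v (differential f) (differential g) = _
  have h1 : vectorFieldDerivation (π.sharp (differential g)) f = -X_ f g := hamiltonian_swap π g f
  have h2 : π.eval (differential f) (differential g) = X_ f g := (hamiltonian_apply π f g).symm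
  have h3 : vectorFieldDerivation (π.sharp (differential f)) g = X_ f g := rfl
  unfold bracketForm
  simp only [lieDerivForm_differential]
  rw [h1, h2, h3, differential_neg, ← vectorFieldDerivation_apply, ← vectorFieldDerivation_apply]
  module

variable {π c v}

omit [T2Space M] in
/-- The Jacobi identity: `{{f, g}, h} = {f, {g, h}} - {g, {f, h}}`. -/
theorem jacobi_hamiltonian (hπ : π.IsPoisson) (f g h : SmoothFunction E M) :
    X_ (X_ f g) h = X_ f (X_ g h) - X_ g (X_ f h) := by
  have := hπ f g h
  simp only [← hamiltonian_apply] at this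
  rw [hamiltonian_swap π (X_ h f) g, hamiltonian_swap π (X_ g h) f, hamiltonian_swap π h f,
    map_neg] at this
  linear_combination this

omit [T2Space M] in
/-- A Casimir function is annihilated by all Hamiltonian derivations. -/
theorem hamiltonian_casimir (hc : π.IsCasimir c) (f : SmoothFunction E M) : X_ f c = 0 := by
  rw [hamiltonian_swap, hamiltonian_apply, hc, neg_zero]

omit [T2Space M] in
/-- If `L_v π = 0`, then `v` is a derivation of the Poisson bracket. -/
theorem derivation_hamiltonian (hv : ∀ α β : OneForm E M, lieDerivBivector v π α β = 0)
    (f g : SmoothFunction E M) : D_ (X_ f g) = X_ (D_ f) g + X_ f (D_ g) := by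
  have := hv (differential f) (differential g)
  unfold lieDerivBivector at this
  rw [lieDerivForm_differential, lieDerivForm_differential] at this
  simp only [hamiltonian_apply]
  exact sub_eq_zero.1 (by rw [← sub_sub]; exact this)

theorem anchorCurvature_differential (hπ : π.IsPoisson) (hc : π.IsCasimir c)
    (hv : ∀ α β : OneForm E M, lieDerivBivector v π α β = 0) (f g : SmoothFunction E M) :
    anchorCurvature (bracketHom π c v) (anchorDerivation π c v) (differential f)
      (differential g) = 0 := by
  ext1 h
  rw [anchorCurvature, bracketHom_differential]
  simp only [map_add, map_sub, map_smul, Derivation.sub_apply, Derivation.add_apply,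
    Derivation.smul_apply, Derivation.commutator_apply, anchorDerivation_differential,
    Derivation.leibniz, smul_eq_mul, hamiltonian_casimir hc, derivation_hamiltonian hv,
    jacobi_hamiltonian hπ, Derivation.zero_apply]
  rw [hamiltonian_swap π g (D_ f)]
  ring

/-- The anchor is a homomorphism of brackets. -/
theorem anchorDerivation_bracketHom (hπ : π.IsPoisson) (hc : π.IsCasimir c)
    (hv : ∀ α β : OneForm E M, lieDerivBivector v π α β = 0) (α β : OneForm E M) :
    anchorDerivation π c v (bracketHom π c v α β) =
      ⁅anchorDerivation π c v α, anchorDerivation π c v β⁆ := by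
  set K := anchorCurvature (bracketHom π c v) (anchorDerivation π c v) with hK
  have hadd (α β γ) : K α (β + γ) = K α β + K α γ := by
    simp only [hK, anchorCurvature, map_add, lie_add]
    abel
  have hsmul (α β) (f : SmoothFunction E M) : K α (f • β) = f • K α β :=
    anchorCurvature_smul_right (bracketHom_smul π c v) α β f
  have hswap (α β) : K α β = -K β α := by
    simp only [hK, anchorCurvature]
    rw [swap_of_alternating (bracketHom_self π c v), map_neg, ← lie_skew]
    abel
  -- By linearity it suffices to treat exact forms, first in one argument, then in the other.
  have hzero (α) (h : ∀ f, K α (differential f) = 0) (β) : K α β = 0 := by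
    ext1 k
    refine eq_zero_of_differential (T := fun β => K α β k) (fun β γ => ?_) (fun f β => ?_)
      (fun f => ?_) β
    · rw [hadd]; rfl
    · rw [hsmul]; rfl
    · rw [h]; rfl
  refine sub_eq_zero.1 (hzero α (fun g => ?_) β)
  rw [hswap, hzero _ (fun f => anchorCurvature_differential hπ hc hv g f), neg_zero]

theorem jacobiator_differential (hπ : π.IsPoisson) (hc : π.IsCasimir c)
    (hv : ∀ α β : OneForm E M, lieDerivBivector v π α β = 0) (f g h : SmoothFunction E M) :
    jacobiator (bracketHom π c v) (differential f) (differential g) (differential h) = 0 := by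
  have swap := swap_of_alternating (bracketHom_self π c v)
  -- The iterated bracket, ordered by the degree in `c`; each part has zero cyclic sum.
  have key (f g h : SmoothFunction E M) :
      bracketHom π c v (bracketHom π c v (differential f) (differential g)) (differential h) =
      differential (X_ (X_ f g) h) +
        c • (D_ h • (differential (X_ (D_ f) g) + differential (X_ f (D_ g)))
          - (X_ (D_ f) g + X_ f (D_ g)) • differential (D_ h)
          + D_ g • differential (X_ (D_ f) h) - D_ f • differential (X_ (D_ g) h)
          + X_ (D_ g) h • differential (D_ f) - X_ (D_ f) h • differential (D_ g))
        + c • D_ c • D_ h • (D_ g • differential (D_ f) - D_ f • differential (D_ g))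
        + c • c • (D_ g • D_ h • differential (D_ (D_ f))
            - D_ f • D_ h • differential (D_ (D_ g))
            + (D_ f * D_ (D_ g) - D_ g * D_ (D_ f)) • differential (D_ h)
            + (D_ h * D_ (D_ g)) • differential (D_ f)
            - (D_ h * D_ (D_ f)) • differential (D_ g)) := by
    rw [swap, bracketHom_differential]
    simp only [map_add, map_sub, smul_sub, bracketHom_smul, bracketHom_differential,
      anchorDerivation_differential, hamiltonian_casimir hc]
    rw [hamiltonian_swap π h (X_ f g), hamiltonian_swap π h (D_ f), hamiltonian_swap π h (D_ g),
      derivation_hamiltonian hv]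
    simp only [differential_neg, differential_add]
    module
  have h1 : differential (X_ (X_ f g) h) + differential (X_ (X_ g h) f) +
      differential (X_ (X_ h f) g) = 0 := by
    have := congrArg differential (hπ f g h)
    simp only [← hamiltonian_apply, differential_add] at this
    rw [add_right_comm, this]
    exact differential_zero
  unfold jacobiator
  rw [key, key, key, hamiltonian_swap π f (D_ g), hamiltonian_swap π g (D_ h),
    hamiltonian_swap π h (D_ f)]
  simp only [differential_neg]
  linear_combination (norm := module) h1

theorem bracketHom_jacobi (hπ : π.IsPoisson) (hc : π.IsCasimir c)
    (hv : ∀ α β : OneForm E M, lieDerivBivector v π α β = 0) (α β γ : OneForm E M) :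
    jacobiator (bracketHom π c v) α β γ = 0 := by
  set J := jacobiator (bracketHom π c v) with hJ
  have hadd (α β γ δ) : J α β (γ + δ) = J α β γ + J α β δ := by
    simp only [hJ, jacobiator, map_add, LinearMap.add_apply]
    abel
  have hsmul (α β γ) (f : SmoothFunction E M) : J α β (f • γ) = f • J α β γ :=
    jacobiator_smul_right (bracketHom_self π c v) (bracketHom_smul π c v)
      (anchorDerivation_bracketHom hπ hc hv) α β γ f
  have hzero (α β) (h : ∀ f, J α β (differential f) = 0) (γ) : J α β γ = 0 := by
    refine oneForm_ext fun x w => ?_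
    obtain ⟨W, rfl⟩ := exists_vectorField_apply_eq w
    have := eq_zero_of_differential (T := fun γ => pairing W (J α β γ)) (fun γ δ => ?_)
      (fun f γ => ?_) (fun f => ?_) γ
    · exact DFunLike.congr_fun this x
    · rw [hadd, map_add]
    · rw [hsmul, map_smul]; rfl
    · rw [h, map_zero]
  -- The Jacobiator is invariant under rotation, so each argument can be moved to the last place.
  refine hzero _ _ (fun h => ?_) γ
  rw [hJ, jacobiator_rotate, jacobiator_rotate]
  refine hzero _ _ (fun g => ?_) β
  rw [hJ, jacobiator_rotate, jacobiator_rotate]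
  exact hzero _ _ (fun f => jacobiator_differential hπ hc hv g h f) α

end

/-! ### The anchor as a smooth bundle map -/

section

section HomSection

variable {E : Type*} [NormedAddCommGroup E] [NormedSpace ℝ E]
  {M : Type*} [TopologicalSpace M] [ChartedSpace E M] [IsManifold 𝓘(ℝ, E) ∞ M]
  {F₁ : Type*} [NormedAddCommGroup F₁] [NormedSpace ℝ F₁] [FiniteDimensional ℝ F₁]
  {V₁ : M → Type*} [TopologicalSpace (TotalSpace F₁ V₁)] [∀ x, TopologicalSpace (V₁ x)]
  [∀ x, AddCommGroup (V₁ x)] [∀ x, Module ℝ (V₁ x)] [FiberBundle F₁ V₁] [VectorBundle ℝ F₁ V₁]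
  {F₂ : Type*} [NormedAddCommGroup F₂] [NormedSpace ℝ F₂]
  {V₂ : M → Type*} [TopologicalSpace (TotalSpace F₂ V₂)] [∀ x, TopologicalSpace (V₂ x)]
  [∀ x, AddCommGroup (V₂ x)] [∀ x, Module ℝ (V₂ x)] [FiberBundle F₂ V₂] [VectorBundle ℝ F₂ V₂]
  [∀ x, IsTopologicalAddGroup (V₂ x)] [∀ x, ContinuousSMul ℝ (V₂ x)]

omit [IsManifold 𝓘(ℝ, E) ∞ M] in
/-- A field of linear maps between vector bundles is smooth at `x` as soon as its values on the
local sections `FiberBundle.extend F₁ w` are. -/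
theorem contMDiffAt_hom_section {T : Π x : M, V₁ x →L[ℝ] V₂ x} {x : M}
    (h : ∀ w : V₁ x, ContMDiffAt 𝓘(ℝ, E) (𝓘(ℝ, E).prod 𝓘(ℝ, F₂)) ∞
      (fun y => TotalSpace.mk' F₂ (E := V₂) y (T y (FiberBundle.extend F₁ w y))) x) :
    ContMDiffAt 𝓘(ℝ, E) (𝓘(ℝ, E).prod 𝓘(ℝ, F₁ →L[ℝ] F₂)) ∞
      (fun y => TotalSpace.mk' (F₁ →L[ℝ] F₂) (E := fun x => V₁ x →L[ℝ] V₂ x) y (T y)) x := by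
  rw [contMDiffAt_hom_bundle]
  refine ⟨contMDiffAt_id, ?_⟩
  let t := trivializationAt F₁ V₁ x
  let t' := trivializationAt F₂ V₂ x
  have hx : x ∈ t.baseSet := FiberBundle.mem_baseSet_trivializationAt' x
  have hx' : x ∈ t'.baseSet := FiberBundle.mem_baseSet_trivializationAt' x
  let b := Module.finBasis ℝ F₁
  -- In the trivializations, `T` is the sum over a basis of `F₁` of rank one maps, whose vector
  -- parts are the values of `T` on the corresponding frame.
  have key : ContMDiffAt 𝓘(ℝ, E) 𝓘(ℝ, F₁ →L[ℝ] F₂) ∞ (fun y => ∑ i,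
      ContinuousLinearMap.smulRightL ℝ F₁ F₂ (LinearMap.toContinuousLinearMap (b.coord i))
        (t' ⟨y, T y (FiberBundle.extend F₁ (t.symm x (b i)) y)⟩).2) x :=
    ContMDiffAt.sum fun i _ => (ContinuousLinearMap.contMDiff _).contMDiffAt.comp x
      ((Bundle.contMDiffAt_section x).1 (h (t.symm x (b i))))
  refine key.congr_of_eventuallyEq ?_
  filter_upwards [t.open_baseSet.mem_nhds hx, t'.open_baseSet.mem_nhds hx'] with y hy hy'
  have he (e : F₁) : FiberBundle.extend F₁ (t.symm x e) y = t.symm y e := by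
    simp only [FiberBundle.extend]
    change t.symm y (t ⟨x, t.symm x e⟩).2 = _
    rw [t.apply_mk_symm hx]
  ext e
  rw [ContinuousLinearMap.inCoordinates_eq hy hy']
  have hr := b.sum_repr e
  conv_lhs => rw [← hr, map_sum]
  rw [sum_apply]
  refine Finset.sum_congr rfl fun i _ => ?_
  rw [map_smul, he]
  simp [t, t']

end HomSection

variable {E : Type*} [NormedAddCommGroup E] [NormedSpace ℝ E] [FiniteDimensional ℝ E]
  {M : Type*} [TopologicalSpace M] [T2Space M] [ChartedSpace E M] [IsManifold 𝓘(ℝ, E) ∞ M]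

/-- The linear map `α ↦ π(α, ·)` from `T*_x M` to `T_x M`, through the identification of `T_x M`
with its bidual. -/
noncomputable def sharpMap (π : Bivector E M) (x : M) :
    CotangentSpace E x →L[ℝ] TangentSpace 𝓘(ℝ, E) x :=
  LinearMap.toContinuousLinearMap (𝕜 := ℝ) (E := E →L[ℝ] ℝ) (F' := E)
    ((Module.evalEquiv ℝ E).symm.toLinearMap ∘ₗ
      ((LinearMap.toContinuousLinearMap : (E →ₗ[ℝ] ℝ) ≃ₗ[ℝ] (E →L[ℝ] ℝ)).toLinearMap.dualMap ∘ₗ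
       ((ContinuousLinearMap.coeLM ℝ : ((E →L[ℝ] ℝ) →L[ℝ] ℝ) →ₗ[ℝ] _) ∘ₗ
        (show (E →L[ℝ] ℝ) →L[ℝ] (E →L[ℝ] ℝ) →L[ℝ] ℝ from π.form x).toLinearMap)))

omit [T2Space M] in
theorem apply_sharpMap (π : Bivector E M) (x : M) (α ξ : CotangentSpace E x) :
    ξ (sharpMap π x α) = π.form x α ξ :=
  Module.apply_evalEquiv_symm_apply (R := ℝ) (M := E) (show E →L[ℝ] ℝ from ξ).toLinearMap _

/-- The rank one map `ξ ↦ ξ(u) u` from `T*_x M` to `T_x M`. -/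
noncomputable def evalVectorSMul (x : M) (u : TangentSpace 𝓘(ℝ, E) x) :
    CotangentSpace E x →L[ℝ] TangentSpace 𝓘(ℝ, E) x :=
  show (E →L[ℝ] ℝ) →L[ℝ] E from
    (ContinuousLinearMap.apply ℝ ℝ (show E from u)).smulRight (show E from u)

/-- The anchor at the point `x`: `ξ ↦ π(ξ, ·) - c(x) ξ(v) v`. -/
noncomputable def anchorMap (π : Bivector E M) (c : SmoothFunction E M) (v : SmoothVectorField E M)
    (x : M) : CotangentSpace E x →L[ℝ] TangentSpace 𝓘(ℝ, E) x :=
  sharpMap π x - c x • evalVectorSMul x (v x)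

omit [T2Space M] in
theorem apply_anchorMap (π : Bivector E M) (c : SmoothFunction E M) (v : SmoothVectorField E M)
    (x : M) (α ξ : CotangentSpace E x) :
    (ξ (anchorMap π c v x α) : ℝ) = π.form x α ξ - c x * (α (v x) * ξ (v x)) := by
  have h1 : anchorMap π c v x α = sharpMap π x α - c x • (α (v x) : ℝ) • v x := rfl
  rw [h1, map_sub, apply_sharpMap, map_smul, map_smul]
  rfl

theorem anchorMap_apply (π : Bivector E M) (c : SmoothFunction E M) (v : SmoothVectorField E M)
    (α : OneForm E M) (x : M) : anchorMap π c v x (α x) = anchorField π c v α x := by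
  refine tangent_ext fun g => ?_
  have h1 : anchorField π c v α x = π.sharp α x - c x • (α x (v x) : ℝ) • v x := by
    have : anchorField π c v α = π.sharp α - c • α.pair v • v := rfl
    rw [this, section_sub_apply]
    rfl
  rw [apply_anchorMap, h1, map_sub, apply_sharp, map_smul, map_smul]
  rfl

/-- The anchor as a smooth bundle map `T*M → TM`. -/
noncomputable def anchorSection (π : Bivector E M) (c : SmoothFunction E M)
    (v : SmoothVectorField E M) : Cₛ^∞⟮𝓘(ℝ, E); (E →L[ℝ] ℝ) →L[ℝ] E,
      (fun x : M => CotangentSpace E x →L[ℝ] TangentSpace 𝓘(ℝ, E) x)⟯ :=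
  ⟨anchorMap π c v, fun x => contMDiffAt_hom_section fun w => contMDiffAt_vector fun T hT => by
    have hw := FiberBundle.contMDiffAt_extend (k := ∞) 𝓘(ℝ, E) (E →L[ℝ] ℝ) w
    have h1 := ContMDiffAt.clm_bundle_apply₂ (π.form.contMDiff x) hw hT
    simp only [Bundle.contMDiffAt_totalSpace] at h1
    have h2 := (c.contMDiff x).mul
      ((contMDiffAt_pair hw (v.contMDiff x)).mul (contMDiffAt_pair hT (v.contMDiff x)))
    exact (h1.2.sub h2).congr_of_eventuallyEq
      (Filter.Eventually.of_forall fun y => apply_anchorMap π c v y _ _)⟩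

/-- The Lie algebroid structure on `T*M` given by a Casimir function `c` and a vector field `v` with
`L_v π = 0`. -/
noncomputable def cotangentLieAlgebroid {π : Bivector E M} {c : SmoothFunction E M}
    {v : SmoothVectorField E M} (hπ : π.IsPoisson) (hc : π.IsCasimir c)
    (hv : ∀ α β : OneForm E M, lieDerivBivector v π α β = 0) :
    LieAlgebroid E (E →L[ℝ] ℝ) (CotangentSpace E : M → Type _) where
  bracket := bracketHom π c v
  anchor := anchorSection π c v
  bracket_self := bracketHom_self π c v
  jacobi := bracketHom_jacobi hπ hc hv
  leibniz α β f x := by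
    have h : anchorSection π c v x (α x) = anchorField π c v α x := anchorMap_apply π c v α x
    rw [h, bracketHom_smul]
    rfl
  anchor_bracket α β x := by
    have h (α : OneForm E M) (y : M) : anchorSection π c v y (α y) = anchorField π c v α y :=
      anchorMap_apply π c v α y
    simp only [h]
    refine tangent_ext fun g => ?_
    rw [differential_mlieBracket]
    exact DFunLike.congr_fun
      (DFunLike.congr_fun (anchorDerivation_bracketHom hπ hc hv α β) g) x

end

end PoissonGeometry

theorem theorem1 {E : Type*} [NormedAddCommGroup E] [NormedSpace ℝ E] [FiniteDimensional ℝ E]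
    {M : Type*} [TopologicalSpace M] [T2Space M] [ChartedSpace E M] [IsManifold 𝓘(ℝ, E) ∞ M]
    (π : PoissonGeometry.Bivector E M) (hπ : π.IsPoisson)
    (c : PoissonGeometry.SmoothFunction E M) (hc : π.IsCasimir c)
    (v : PoissonGeometry.SmoothVectorField E M)
    (hv : ∀ α β : PoissonGeometry.OneForm E M, PoissonGeometry.lieDerivBivector v π α β = 0) :
    ∃ A : PoissonGeometry.LieAlgebroid E (E →L[ℝ] ℝ)
        (PoissonGeometry.CotangentSpace E : M → Type _),
      (∀ α β : PoissonGeometry.OneForm E M,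
        A.bracket α β =
          PoissonGeometry.lieDerivForm (π.sharp α) β - PoissonGeometry.lieDerivForm (π.sharp β) α
            - PoissonGeometry.differential (π.eval α β)
            + c • (β.pair v • PoissonGeometry.lieDerivForm v α
              - α.pair v • PoissonGeometry.lieDerivForm v β)) ∧
      (∀ (α : PoissonGeometry.OneForm E M) (f : PoissonGeometry.SmoothFunction E M) (x : M),
        PoissonGeometry.differential f x (A.anchor x (α x)) =
          π.eval α (PoissonGeometry.differential f) x
            - c x * α.pair v x * (PoissonGeometry.differential f).pair v x) := by
  refine ⟨PoissonGeometry.cotangentLieAlgebroid hπ hc hv, fun α β => rfl, fun α f x => ?_⟩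
  refine (PoissonGeometry.apply_anchorMap π c v x (α x)
    (PoissonGeometry.differential f x)).trans ?_
  rw [← mul_assoc]
  rfl
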